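/- For a finite group $G$, let $m_{\mathsf{faithful}}(G)$ denote the smallest dimension of a faithful complex representation of $G$, i.e. the least $d\ge 0$ such that $G$ embeds into $\mathrm{GL}_d(\mathbb{C})$. For a commutative ring $R$ and $m\ge 0$, let $\mathbf{U}_m(R)\subseteq \mathrm{GL}_m(R)$ be the group of upper triangular $m\times m$ matrices with all diagonal entries equal to $1$, and for $k\ge 0$ let $$\mathrm{Hei}_{2k+1}(R)=\left\{\begin{pmatrix}1&\mathbf{x}&z\\0&I_k&\mathbf{y}^T\\0&0&1\end{pmatrix} : \mathbf{x},\mathbf{y}\in R^k,\ z\in R\right\}\subseteq \mathbf{U}_{k+2}(R)$$ be the Heisenberg group. Let $F$ be a non-Archimedean local field with ring of integers $\mathcal{O}$ and maximal ideal $\mathfrak{p}$, and assume that $\mathrm{char}(\mathcal{O}/\mathfrak{p})\neq 2$. Let $k,n\ge 0$ be integers and let $G$ be a group with $$\mathrm{Hei}_{2k+1}(\mathcal{O}/\mathfrak{p}^n)\subseteq G\subseteq \mathbf{U}_{k+2}(\mathcal{O}/\mathfrak{p}^n).$$ Then $$m_{\mathsf{faithful}}(G)=m_{\mathsf{faithful}}(\mathrm{Hei}_{2k+1}(\mathcal{O}/\mathfrak{p}^n)).$$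 -/

import Mathlib

open scoped ValuativeRel

/-- The smallest dimension of a faithful complex representation of `G`: the least `d` such that
`G` embeds into `GL_d(ℂ)`. For a finite group such a `d` exists; the value is `⊤` if there is
none. -/
noncomputable def mFaithful (G : Type*) [Group G] : ℕ∞ :=
  ⨅ (d : ℕ) (_ : ∃ ρ : G →* GL (Fin d) ℂ, Function.Injective ρ), (d : ℕ∞)

/-- The group of upper triangular `m × m` matrices over `R` with all diagonal entries `1`. -/
def unitriangular (m : ℕ) (R : Type*) [CommRing R] : Subgroup (GL (Fin m) R) where
  carrier := {g | (∀ i, g.val i i = 1) ∧ ∀ i j, j < i → g.val i j = 0}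
  one_mem' := by
    refine ⟨fun i => by simp, fun i j h => ?_⟩
    simp [Matrix.one_apply_ne h.ne']
  mul_mem' := by
    rintro a b ⟨ha, ha'⟩ ⟨hb, hb'⟩
    refine ⟨fun i => ?_, fun i j hij => ?_⟩
    · rw [Units.val_mul, Matrix.mul_apply, Finset.sum_eq_single i]
      · rw [ha, hb, one_mul]
      · intro l _ hl
        rcases lt_or_gt_of_ne hl with h | h
        · rw [ha' _ _ h, zero_mul]
        · rw [hb' _ _ h, mul_zero]
      · simp
    · rw [Units.val_mul, Matrix.mul_apply]
      refine Finset.sum_eq_zero fun l _ => ?_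
      rcases lt_or_ge l i with h | h
      · rw [ha' _ _ h, zero_mul]
      · rw [hb' _ _ (hij.trans_le h), mul_zero]
  inv_mem' := by
    rintro a ⟨ha, ha'⟩
    have hinv : ∀ i j, j < i → a⁻¹.val i j = 0 := by
      have h : Matrix.BlockTriangular a.val id := fun i j h => ha' i j h
      have h2 := Matrix.blockTriangular_inv_of_blockTriangular (M := a.val) h
      intro i j hij
      rw [Matrix.coe_units_inv]
      exact h2 hij
    refine ⟨fun i => ?_, hinv⟩
    have h1 : (a.val * a⁻¹.val) i i = 1 := by
      rw [← Units.val_mul, mul_inv_cancel]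
      simp
    rw [Matrix.mul_apply, Finset.sum_eq_single i] at h1
    · rwa [ha, one_mul] at h1
    · intro l _ hl
      rcases lt_or_gt_of_ne hl with h | h
      · rw [ha' _ _ h, zero_mul]
      · rw [hinv _ _ h, mul_zero]
    · simp

/-- The `(k + 2) × (k + 2)` matrix with rows `(1, x, z)`, `(0, I_k, yᵀ)`, `(0, 0, 1)`. -/
def heisenbergMatrix {k : ℕ} {R : Type*} [CommRing R] (x y : Fin k → R) (z : R) :
    Matrix (Fin (k + 2)) (Fin (k + 2)) R :=
  Matrix.of <| Fin.cons (α := fun _ => Fin (k + 2) → R)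
    (Fin.cons (α := fun _ => R) 1 (Fin.snoc (α := fun _ => R) x z))
    (Fin.snoc (α := fun _ => Fin (k + 2) → R)
      (fun i => Fin.cons (α := fun _ => R) 0
        (Fin.snoc (α := fun _ => R) ((1 : Matrix (Fin k) (Fin k) R) i) (y i)))
      (Fin.cons (α := fun _ => R) 0 (Fin.snoc (α := fun _ => R) (fun _ => 0) 1)))

theorem heisenbergMatrix_zero {k : ℕ} {R : Type*} [CommRing R] :
    heisenbergMatrix (0 : Fin k → R) 0 0 = 1 := by
  ext i j
  refine Fin.cases ?_ (fun i => Fin.lastCases ?_ (fun i => ?_) i) i <;>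
    refine Fin.cases ?_ (fun j => Fin.lastCases ?_ (fun j => ?_) j) j <;>
    simp [heisenbergMatrix, Matrix.one_apply, Fin.ext_iff] <;> grind

theorem heisenbergMatrix_mul {k : ℕ} {R : Type*} [CommRing R] (x y x' y' : Fin k → R)
    (z z' : R) : heisenbergMatrix x y z * heisenbergMatrix x' y' z' =
      heisenbergMatrix (x + x') (y + y') (z + z' + x ⬝ᵥ y') := by
  ext i j
  rw [Matrix.mul_apply, Fin.sum_univ_succ, Fin.sum_univ_castSucc]
  refine Fin.cases ?_ (fun i => Fin.lastCases ?_ (fun i => ?_) i) i <;>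
    refine Fin.cases ?_ (fun j => Fin.lastCases ?_ (fun j => ?_) j) j <;>
    simp [heisenbergMatrix, Matrix.one_apply, dotProduct] <;> ring

/-- The Heisenberg group `Hei_{2k+1}(R)` of all matrices with rows
`(1, x, z)`, `(0, I_k, yᵀ)`, `(0, 0, 1)`. -/
def heisenberg (k : ℕ) (R : Type*) [CommRing R] : Subgroup (GL (Fin (k + 2)) R) where
  carrier := {g | ∃ (x y : Fin k → R) (z : R), g.val = heisenbergMatrix x y z}
  one_mem' := ⟨0, 0, 0, by rw [heisenbergMatrix_zero, Units.val_one]⟩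
  mul_mem' := by
    rintro a b ⟨x, y, z, h⟩ ⟨x', y', z', h'⟩
    exact ⟨_, _, _, by rw [Units.val_mul, h, h', heisenbergMatrix_mul]⟩
  inv_mem' := by
    rintro a ⟨x, y, z, h⟩
    refine ⟨-x, -y, x ⬝ᵥ y - z, ?_⟩
    apply Units.inv_eq_of_mul_eq_one_right
    rw [h, heisenbergMatrix_mul, ← heisenbergMatrix_zero]
    congr 1 <;> simp

/-! The argument runs over any finite commutative ring `R`. Restriction gives `mFaithful (heisenberg
k R) ≤ mFaithful G`. Conversely, let the Heisenberg group act faithfully in dimension `d`, and let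
`S` be the set of central characters that occur; faithfulness makes `S` separate points of `R`. For
`ψ ∈ S`, conjugating by the elements with coordinate `y` moves one weight of the abelian subgroup `y
= 0` through an orbit indexed by `(R ⧸ ψ.conductor) ^ k`. All these weights are distinct, so the
orbit sizes add up to at most `d` (`exists_separating_characters`). The same index set carries a
faithful monomial representation of all of `G`: a unitriangular `g` sends the column `(0, v, 1)` to
`(t, v', 1)`, so `v ↦ v'` permutes the indices and `ψ t` is the coefficient
(`mFaithful_le_of_separating`). -/

open scoped Matrix

/-! ### Weights of a finite abelian group. -/

section JointEigenvectors

variable {A V : Type*} [AddCommGroup A] [AddCommGroup V] [Module ℂ V]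

/-- `v` is a joint eigenvector of the operators `T a` with eigenvalues `χ a`, or zero. -/
def IsWeightVector (T : A → Module.End ℂ V) (χ : AddChar A ℂ) (v : V) : Prop :=
  ∀ a, T a v = χ a • v

theorem linearIndependent_of_isWeightVector [Finite A] {ι : Type*} {T : A → Module.End ℂ V}
    {χ : ι → AddChar A ℂ} (hχ : Function.Injective χ) {v : ι → V} (hv : ∀ i, v i ≠ 0)
    (h : ∀ i, IsWeightVector T (χ i) (v i)) : LinearIndependent ℂ v := by
  rw [linearIndependent_iff']
  intro s c hc i hi
  -- Applying a functional reduces the claim to the linear independence of distinct characters.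
  have key : ∀ φ : Module.Dual ℂ V, c i * φ (v i) = 0 := by
    intro φ
    have hlin := (AddChar.linearIndependent A ℂ).comp χ hχ
    rw [linearIndependent_iff'] at hlin
    refine hlin s (fun j => c j * φ (v j)) ?_ i hi
    funext a
    have h1 := congrArg (fun w => φ (T a w)) hc
    simp only [map_sum, map_smul, map_zero, h _ a, smul_eq_mul] at h1
    rw [Finset.sum_apply, Pi.zero_apply, ← h1]
    refine Finset.sum_congr rfl fun j _ => ?_
    simp only [Function.comp_apply, Pi.smul_apply, smul_eq_mul]
    ring
  by_contra hci
  exact hv i ((Module.forall_dual_apply_eq_zero_iff ℂ (v i)).1 fun φ =>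
    (mul_eq_zero.1 (key φ)).resolve_left hci)

/-- An operator fixing all joint eigenvectors of a finite abelian group is the identity. -/
theorem eq_one_of_forall_isWeightVector [Finite A] {T : A → Module.End ℂ V} (h0 : T 0 = 1)
    (hadd : ∀ a b, T (a + b) = T a * T b) {P : Module.End ℂ V}
    (hP : ∀ χ v, IsWeightVector T χ v → P v = v) : P = 1 := by
  classical
  have := Fintype.ofFinite A
  ext v
  -- Up to the factor `|A|`, the projections of `v` to the weight spaces; by orthogonality of
  -- characters they sum to `|A| • v`.
  set w : AddChar A ℂ → V := fun χ => ∑ a, χ (-a) • T a v with hw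
  have hwt : ∀ χ, IsWeightVector T χ (w χ) := by
    intro χ b
    simp only [hw, map_sum, map_smul, Finset.smul_sum]
    refine Fintype.sum_equiv (Equiv.addLeft b) _ _ fun a => ?_
    rw [Equiv.coe_addLeft, hadd, smul_smul, ← AddChar.map_add_eq_mul]
    simp
  have hsum : ∑ χ, w χ = (Fintype.card A : ℂ) • v := by
    simp only [hw]
    rw [Finset.sum_comm]
    simp only [← Finset.sum_smul, AddChar.sum_apply_eq_ite, neg_eq_zero, ite_smul, zero_smul,
      Finset.sum_ite_eq', Finset.mem_univ, if_true, h0, Module.End.one_apply]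
  have hcard : (Fintype.card A : ℂ) ≠ 0 := Nat.cast_ne_zero.2 Fintype.card_ne_zero
  have hPs : P ((Fintype.card A : ℂ) • v) = (Fintype.card A : ℂ) • v := by
    rw [← hsum, map_sum]
    exact Finset.sum_congr rfl fun χ _ => hP χ _ (hwt χ)
  rw [map_smul] at hPs
  exact smul_right_injective V hcard hPs

end JointEigenvectors

/-! ### Conductors of additive characters. -/

section Conductor

variable {R : Type*} [CommRing R]

/-- The largest ideal contained in the kernel of an additive character. -/
def AddChar.conductor (ψ : AddChar R ℂ) : Ideal R where
  carrier := {a | ∀ r, ψ (r * a) = 1}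
  zero_mem' := by simp
  add_mem' := by
    intro a b ha hb r
    rw [mul_add, AddChar.map_add_eq_mul, ha, hb, one_mul]
  smul_mem' := by
    intro c a ha r
    rw [smul_eq_mul, ← mul_assoc]
    exact ha _

theorem AddChar.mem_conductor {ψ : AddChar R ℂ} {a : R} :
    a ∈ ψ.conductor ↔ ∀ r, ψ (r * a) = 1 := Iff.rfl

theorem AddChar.apply_eq_of_sub_mem_conductor {ψ : AddChar R ℂ} {a b : R}
    (h : a - b ∈ ψ.conductor) : ψ a = ψ b := by
  have h1 := h 1
  rw [one_mul] at h1
  rw [← sub_add_cancel a b, AddChar.map_add_eq_mul, h1, one_mul]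

/-- The index set of the direct sum, over `ψ ∈ S`, of the functions on `(R ⧸ ψ.conductor) ^ k`. -/
abbrev ConductorIndex (k : ℕ) (S : Set (AddChar R ℂ)) : Type _ :=
  Σ ψ : S, Fin k → R ⧸ (ψ : AddChar R ℂ).conductor

end Conductor

/-! ### Lower bound from a faithful Heisenberg representation. -/

section Heisenberg

variable {k : ℕ} {R : Type*} [CommRing R]

/-- The element of the Heisenberg group with coordinates `x`, `y`, `z`. -/
def heisenbergMk (x y : Fin k → R) (z : R) : heisenberg k R :=
  ⟨⟨heisenbergMatrix x y z, heisenbergMatrix (-x) (-y) (x ⬝ᵥ y - z),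
    by rw [heisenbergMatrix_mul, ← heisenbergMatrix_zero]; congr 1 <;> simp,
    by rw [heisenbergMatrix_mul, ← heisenbergMatrix_zero]; congr 1 <;> simp⟩, x, y, z, rfl⟩

theorem heisenbergMk_mul (x y x' y' : Fin k → R) (z z' : R) :
    heisenbergMk x y z * heisenbergMk x' y' z' =
      heisenbergMk (x + x') (y + y') (z + z' + x ⬝ᵥ y') :=
  Subtype.ext (Units.ext (heisenbergMatrix_mul x y x' y' z z'))

theorem heisenbergMk_zero : heisenbergMk (0 : Fin k → R) 0 0 = 1 :=
  Subtype.ext (Units.ext heisenbergMatrix_zero)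

theorem eq_zero_of_heisenbergMk_eq_one {z : R} (h : heisenbergMk (0 : Fin k → R) 0 z = 1) :
    z = 0 := by
  have h1 := congrArg (fun g : heisenberg k R => g.1.val 0 (Fin.last (k + 1))) h
  have h2 : heisenbergMatrix (0 : Fin k → R) 0 z 0 (Fin.last (k + 1)) = z := by
    rw [← Fin.succ_last]
    simp [heisenbergMatrix]
  have h3 : (1 : Matrix (Fin (k + 2)) (Fin (k + 2)) R) 0 (Fin.last (k + 1)) = 0 :=
    Matrix.one_apply_ne (by simp [Fin.ext_iff])
  exact h2.symm.trans (h1.trans h3)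

/-- A faithful representation of the Heisenberg group yields a separating set of central
characters whose orbits fit into its dimension. -/
theorem exists_separating_characters [Finite R] {V : Type*} [AddCommGroup V] [Module ℂ V]
    [FiniteDimensional ℂ V] (ρ : heisenberg k R →* Module.End ℂ V) (hρ : Function.Injective ρ) :
    ∃ S : Set (AddChar R ℂ), (∀ z, (∀ ψ ∈ S, ψ z = 1) → z = 0) ∧
      Nat.card (ConductorIndex k S) ≤ Module.finrank ℂ V := by
  set T : (Fin k → R) × R → Module.End ℂ V := fun a => ρ (heisenbergMk a.1 0 a.2) with hT
  have hT0 : T 0 = 1 := by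
    simp only [hT, Prod.fst_zero, Prod.snd_zero, heisenbergMk_zero, map_one]
  have hTadd : ∀ a b, T (a + b) = T a * T b := by
    intro a b
    simp [hT, ← map_mul, heisenbergMk_mul]
  set res : AddChar ((Fin k → R) × R) ℂ → AddChar R ℂ :=
    fun χ => χ.compAddMonoidHom (AddMonoidHom.inr (Fin k → R) R) with hres
  have hres' : ∀ χ z, res χ z = χ (0, z) := fun χ z => rfl
  let S : Set (AddChar R ℂ) := {ψ | ∃ χ v, v ≠ 0 ∧ IsWeightVector T χ v ∧ res χ = ψ}
  refine ⟨S, fun z hz => ?_, ?_⟩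
  · refine eq_zero_of_heisenbergMk_eq_one (k := k) (hρ ?_)
    rw [map_one]
    refine eq_one_of_forall_isWeightVector hT0 hTadd fun χ v hv => ?_
    by_cases h0 : v = 0
    · rw [h0, map_zero]
    · have h1 := hz (res χ) ⟨χ, v, h0, hv, rfl⟩
      have h2 := hv (0, z)
      rwa [← hres', h1, one_smul] at h2
  · choose χ v hv0 hv hχ using fun ψ : S => ψ.2
    let lift : ∀ i : ConductorIndex k S, Fin k → R := fun i j => (i.2 j).out
    -- Conjugation by `heisenbergMk 0 y 0` on the subgroup `y = 0`, hence its effect on weights.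
    let shear : (Fin k → R) → ((Fin k → R) × R →+ (Fin k → R) × R) := fun y =>
      AddMonoidHom.mk' (fun a => (a.1, a.2 + a.1 ⬝ᵥ y)) fun a b => by
        refine Prod.ext rfl ?_
        simp only [Prod.snd_add, Prod.fst_add, add_dotProduct]
        ring
    let χ' : ConductorIndex k S → AddChar ((Fin k → R) × R) ℂ := fun i =>
      (χ i.1).compAddMonoidHom (shear (lift i))
    have hχ' : ∀ i x z, χ' i (x, z) = χ i.1 (x, 0) * (i.1 : AddChar R ℂ) (z + x ⬝ᵥ lift i) := by
      intro i x z
      rw [← hχ i.1, hres', ← AddChar.map_add_eq_mul]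
      simp [χ', shear]
    have hinj : Function.Injective χ' := by
      rintro ⟨ψ, y⟩ ⟨ψ', y'⟩ h
      have hψ : ψ = ψ' := by
        refine Subtype.ext (DFunLike.ext _ _ fun z => ?_)
        have h1 := DFunLike.congr_fun h (0, z)
        rw [hχ', hχ'] at h1
        have e : ∀ ψ : S, χ ψ (0, 0) = 1 := fun ψ => AddChar.map_zero_eq_one (χ ψ)
        simpa [e] using h1
      subst hψ
      congr 1
      funext j
      rw [← Ideal.Quotient.mk_out (y j), ← Ideal.Quotient.mk_out (y' j), Ideal.Quotient.eq]
      intro r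
      -- Testing on all multiples `r` of the `j`-th basis vector shows that the lifts differ there
      -- by an element of the conductor.
      have h1 := DFunLike.congr_fun h (Pi.single j r, 0)
      rw [hχ', hχ'] at h1
      have h2 := mul_left_cancel₀ ((AddChar.val_isUnit (χ ψ) _).ne_zero) h1
      simp only [zero_add, single_dotProduct, lift] at h2
      rw [mul_sub, sub_eq_add_neg, AddChar.map_add_eq_mul, h2, ← AddChar.map_add_eq_mul,
        add_neg_cancel, AddChar.map_zero_eq_one]
    have hfin : Finite (ConductorIndex k S) := Finite.of_injective χ' hinj
    have := Fintype.ofFinite (ConductorIndex k S)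
    rw [Nat.card_eq_fintype_card]
    refine (linearIndependent_of_isWeightVector (T := T) hinj
      (v := fun i => ρ (heisenbergMk 0 (lift i) 0) (v i.1)) (fun i h => ?_)
      fun i a => ?_).fintype_card_le_finrank
    · have h1 := congrArg (ρ (heisenbergMk 0 (-lift i) 0)) h
      rw [← Module.End.mul_apply, ← map_mul, heisenbergMk_mul] at h1
      simp [heisenbergMk_zero] at h1
      exact hv0 _ h1
    · obtain ⟨x, z⟩ := a
      have h1 := congrArg (ρ (heisenbergMk 0 (lift i) 0)) (hv i.1 (x, z + x ⬝ᵥ lift i))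
      have h2 : heisenbergMk x 0 z * heisenbergMk 0 (lift i) 0 =
          heisenbergMk 0 (lift i) 0 * heisenbergMk x 0 (z + x ⬝ᵥ lift i) := by
        simp [heisenbergMk_mul]
      simp only [hT]
      rw [← Module.End.mul_apply, ← map_mul, h2, map_mul, Module.End.mul_apply]
      refine h1.trans ?_
      rw [map_smul]
      rfl

end Heisenberg

/-! ### Monomial representations. -/

section Monomial

/-- The matrix representation of a monomial action. -/
def monomialRep {G ι K : Type*} [Group G] [MulAction G ι] [Fintype ι] [DecidableEq ι]
    [CommRing K] (c : G → ι → K) (h1 : ∀ i, c 1 i = 1)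
    (hmul : ∀ g h i, c (g * h) i = c g (h • i) * c h i) : G →* Matrix ι ι K where
  toFun g := Matrix.of fun i j => if i = g • j then c g j else 0
  map_one' := by
    ext i j
    simp [Matrix.one_apply, h1]
  map_mul' g h := by
    ext i j
    simp [Matrix.mul_apply, mul_smul, hmul]

theorem monomialRep_eq_one {G ι K : Type*} [Group G] [MulAction G ι] [Fintype ι]
    [DecidableEq ι] [CommRing K] [Nontrivial K] {c : G → ι → K} {h1 : ∀ i, c 1 i = 1}
    {hmul : ∀ g h i, c (g * h) i = c g (h • i) * c h i} {g : G}
    (h : monomialRep c h1 hmul g = 1) (i : ι) : g • i = i ∧ c g i = 1 := by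
  have h2 := congrFun (congrFun h i) i
  simp only [monomialRep, MonoidHom.coe_mk, OneHom.coe_mk, Matrix.of_apply,
    Matrix.one_apply_eq] at h2
  split_ifs at h2 with h3
  · exact ⟨h3.symm, h2⟩
  · exact absurd h2 zero_ne_one

theorem mFaithful_le_card {G ι : Type*} [Group G] [Fintype ι] [DecidableEq ι]
    (ρ : G →* Matrix ι ι ℂ) (hρ : Function.Injective ρ) :
    mFaithful G ≤ Fintype.card ι := by
  let e := (Matrix.reindexAlgEquiv ℂ ℂ (Fintype.equivFin ι)).toMulEquiv
  refine iInf₂_le (Fintype.card ι) ⟨(e.toMonoidHom.comp ρ).toHomUnits, fun g h hgh => ?_⟩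
  exact hρ (e.injective (congrArg Units.val hgh))

end Monomial

/-! ### The monomial representation of a unitriangular group. -/

section AffineAction

variable {k : ℕ} {R : Type*} [CommRing R]

/-- The column vector `(0, v, 1)`. -/
def affineVec (v : Fin k → R) : Fin (k + 2) → R :=
  Fin.cons (α := fun _ => R) 0 (Fin.snoc (α := fun _ => R) v 1)

/-- The top coordinate of `g (0, v, 1)`. -/
def affineTop (g : Matrix (Fin (k + 2)) (Fin (k + 2)) R) (v : Fin k → R) : R :=
  (g *ᵥ affineVec v) 0

/-- The middle coordinates of `g (0, v, 1)`. -/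
def affineMid (g : Matrix (Fin (k + 2)) (Fin (k + 2)) R) (v : Fin k → R) : Fin k → R :=
  fun i => (g *ᵥ affineVec v) i.castSucc.succ

theorem mulVec_affineVec {g : GL (Fin (k + 2)) R} (hg : g ∈ unitriangular (k + 2) R)
    (v : Fin k → R) : g.val *ᵥ affineVec v =
      affineVec (affineMid g.val v) + affineTop g.val v • Pi.single 0 1 := by
  funext i
  refine Fin.cases ?_ (fun i => Fin.lastCases ?_ (fun i => ?_) i) i
  · simp [affineVec, affineTop]
  · have h1 : (g.val *ᵥ affineVec v) (Fin.last k).succ = 1 := by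
      rw [Matrix.mulVec, dotProduct, Finset.sum_eq_single (Fin.last k).succ]
      · rw [hg.1]
        simp [affineVec]
      · intro j _ hj
        rw [hg.2 _ _ (lt_of_le_of_ne (by simpa using Fin.le_last j) hj), zero_mul]
      · simp
    rw [h1]
    simp [affineVec]
  · simp [affineVec, affineMid]

theorem mulVec_single_zero {g : GL (Fin (k + 2)) R} (hg : g ∈ unitriangular (k + 2) R) :
    g.val *ᵥ Pi.single 0 1 = Pi.single 0 1 := by
  funext i
  rw [Matrix.mulVec_single_one, Matrix.col_apply]
  by_cases h : i = 0
  · subst h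
    simp [hg.1]
  · rw [hg.2 _ _ (Fin.pos_iff_ne_zero.2 h), Pi.single_eq_of_ne h]

theorem mul_mulVec_affineVec {g h : GL (Fin (k + 2)) R} (hg : g ∈ unitriangular (k + 2) R)
    (hh : h ∈ unitriangular (k + 2) R) (v : Fin k → R) :
    (g * h).val *ᵥ affineVec v = affineVec (affineMid g.val (affineMid h.val v)) +
      (affineTop g.val (affineMid h.val v) + affineTop h.val v) • Pi.single 0 1 := by
  rw [Units.val_mul, ← Matrix.mulVec_mulVec, mulVec_affineVec hh, Matrix.mulVec_add,
    mulVec_affineVec hg, Matrix.mulVec_smul, mulVec_single_zero hg, add_smul, add_assoc]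

/-- This cocycle identity is what makes the coefficients `ψ (affineTop g v)` multiplicative. -/
theorem affineTop_mul {g h : GL (Fin (k + 2)) R} (hg : g ∈ unitriangular (k + 2) R)
    (hh : h ∈ unitriangular (k + 2) R) (v : Fin k → R) : affineTop (g * h).val v =
      affineTop g.val (affineMid h.val v) + affineTop h.val v := by
  rw [affineTop, mul_mulVec_affineVec hg hh]
  simp [affineVec]

theorem affineMid_mul {g h : GL (Fin (k + 2)) R} (hg : g ∈ unitriangular (k + 2) R)
    (hh : h ∈ unitriangular (k + 2) R) (v : Fin k → R) :
    affineMid (g * h).val v = affineMid g.val (affineMid h.val v) := by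
  funext i
  rw [affineMid, mul_mulVec_affineVec hg hh]
  simp [affineVec]

theorem affineTop_one (v : Fin k → R) : affineTop 1 v = 0 := by
  simp [affineTop, affineVec]

theorem affineMid_one (v : Fin k → R) : affineMid 1 v = v := by
  funext i
  simp [affineMid, affineVec]

/-- Serves both to let the affine action descend modulo `I` and to make the coefficients independent
of the chosen lifts. -/
theorem mulVec_affineVec_sub_mem {I : Ideal R} (g : Matrix (Fin (k + 2)) (Fin (k + 2)) R)
    {v w : Fin k → R} (h : ∀ i, v i - w i ∈ I) (i : Fin (k + 2)) :
    (g *ᵥ affineVec v) i - (g *ᵥ affineVec w) i ∈ I := by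
  rw [← Pi.sub_apply, ← Matrix.mulVec_sub]
  rw [Matrix.mulVec, dotProduct]
  refine I.sum_mem fun j _ => I.mul_mem_left _ ?_
  refine Fin.cases ?_ (fun j => Fin.lastCases ?_ (fun j => ?_) j) j
  · simp [affineVec]
  · simp [affineVec]
  · simpa [affineVec] using h j

/-- The columns `(0, v, 1)`, together with the first basis vector, which `g` always fixes, span the
whole space. -/
theorem eq_one_of_affine_eq {g : GL (Fin (k + 2)) R} (hg : g ∈ unitriangular (k + 2) R)
    (htop : ∀ v, affineTop g.val v = 0) (hmid : ∀ v, affineMid g.val v = v) : g = 1 := by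
  have h (v : Fin k → R) : g.val *ᵥ affineVec v = affineVec v := by
    rw [mulVec_affineVec hg, htop, hmid, zero_smul, add_zero]
  have hlast : affineVec (0 : Fin k → R) = Pi.single (Fin.last k).succ 1 := by
    funext i
    refine Fin.cases ?_ (fun i => Fin.lastCases ?_ (fun i => ?_) i) i <;>
      simp [affineVec, Pi.single_apply, Fin.ext_iff]
    omega
  have hsingle (j : Fin k) : affineVec (Pi.single j (1 : R)) - affineVec 0 =
      Pi.single j.castSucc.succ 1 := by
    funext i
    refine Fin.cases ?_ (fun i => Fin.lastCases ?_ (fun i => ?_) i) i <;>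
      simp [affineVec, Pi.single_apply, Fin.ext_iff]
    omega
  refine Units.ext (Matrix.ext_of_mulVec_single fun i => ?_)
  rw [Units.val_one, Matrix.one_mulVec]
  refine Fin.cases (mulVec_single_zero hg) (fun i => Fin.lastCases ?_ (fun i => ?_) i) i
  · rw [← hlast, h]
  · rw [← hsingle, Matrix.mulVec_sub, h, h]

variable {G : Subgroup (GL (Fin (k + 2)) R)}

/-- The transformation of `(R ⧸ I) ^ k` induced by the affine map `v ↦ A v + y`, where `A`, `y` are
the middle blocks of `g`. -/
noncomputable def affineMidQuotient (I : Ideal R) (g : Matrix (Fin (k + 2)) (Fin (k + 2)) R)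
    (u : Fin k → R ⧸ I) : Fin k → R ⧸ I :=
  fun i => Ideal.Quotient.mk I (affineMid g (fun j => (u j).out) i)

theorem affineMidQuotient_mk (I : Ideal R) (g : Matrix (Fin (k + 2)) (Fin (k + 2)) R)
    (v : Fin k → R) : affineMidQuotient I g (fun i => Ideal.Quotient.mk I (v i)) =
      fun i => Ideal.Quotient.mk I (affineMid g v i) := by
  funext i
  refine Ideal.Quotient.eq.2 (mulVec_affineVec_sub_mem g (fun j => ?_) _)
  exact Ideal.Quotient.eq.1 (Ideal.Quotient.mk_out _)

theorem apply_affineTop_out (ψ : AddChar R ℂ) (g : Matrix (Fin (k + 2)) (Fin (k + 2)) R)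
    (v : Fin k → R) :
    ψ (affineTop g fun i => (Ideal.Quotient.mk ψ.conductor (v i)).out) = ψ (affineTop g v) := by
  refine AddChar.apply_eq_of_sub_mem_conductor (mulVec_affineVec_sub_mem g (fun j => ?_) _)
  exact Ideal.Quotient.eq.1 (Ideal.Quotient.mk_out _)

theorem exists_eq_mk_comp {I : Ideal R} (u : Fin k → R ⧸ I) :
    ∃ v : Fin k → R, u = fun i => Ideal.Quotient.mk I (v i) :=
  ⟨fun i => (u i).out, funext fun i => (Ideal.Quotient.mk_out (u i)).symm⟩

/-- The action of a group of unitriangular matrices on the index set `ConductorIndex k S`. -/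
noncomputable abbrev conductorIndexAction (hG : G ≤ unitriangular (k + 2) R)
    (S : Set (AddChar R ℂ)) : MulAction G (ConductorIndex k S) where
  smul g i := ⟨i.1, affineMidQuotient _ g.1.val i.2⟩
  one_smul := by
    rintro ⟨ψ, u⟩
    obtain ⟨v, rfl⟩ := exists_eq_mk_comp u
    refine congrArg (Sigma.mk ψ) ?_
    change affineMidQuotient _ 1 _ = _
    rw [affineMidQuotient_mk, affineMid_one]
  mul_smul := by
    rintro g h ⟨ψ, u⟩
    obtain ⟨v, rfl⟩ := exists_eq_mk_comp u
    refine congrArg (Sigma.mk ψ) ?_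
    change affineMidQuotient _ (g.1 * h.1).val _ = affineMidQuotient _ _ (affineMidQuotient _ _ _)
    rw [affineMidQuotient_mk, affineMidQuotient_mk, affineMidQuotient_mk,
      affineMid_mul (hG g.2) (hG h.2)]

/-- A group of unitriangular matrices acts faithfully on the monomial representation attached to
a separating set of characters. -/
theorem mFaithful_le_of_separating [Finite R] (hG : G ≤ unitriangular (k + 2) R)
    {S : Set (AddChar R ℂ)} (hS : ∀ z, (∀ ψ ∈ S, ψ z = 1) → z = 0) :
    mFaithful G ≤ Nat.card (ConductorIndex k S) := by
  classical
  have hfin (ψ : S) : Finite (R ⧸ (ψ : AddChar R ℂ).conductor) :=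
    Finite.of_surjective _ Ideal.Quotient.mk_surjective
  have := Fintype.ofFinite (ConductorIndex k S)
  rw [Nat.card_eq_fintype_card]
  let := conductorIndexAction hG S
  let c : G → ConductorIndex k S → ℂ := fun g i =>
    (i.1 : AddChar R ℂ) (affineTop g.1.val fun j => (i.2 j).out)
  have hc (g : G) (ψ : S) (v : Fin k → R) : c g ⟨ψ, fun i => Ideal.Quotient.mk _ (v i)⟩ =
      (ψ : AddChar R ℂ) (affineTop g.1.val v) := apply_affineTop_out _ _ _
  have hsmul (g : G) (ψ : S) (v : Fin k → R) :
      g • (⟨ψ, fun i => Ideal.Quotient.mk _ (v i)⟩ : ConductorIndex k S) =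
        ⟨ψ, fun i => Ideal.Quotient.mk _ (affineMid g.1.val v i)⟩ :=
    congrArg (Sigma.mk ψ) (affineMidQuotient_mk _ _ _)
  have h1 (i) : c 1 i = 1 := by
    change (i.1 : AddChar R ℂ) (affineTop 1 _) = 1
    rw [affineTop_one, AddChar.map_zero_eq_one]
  have hmul (g h i) : c (g * h) i = c g (h • i) * c h i := by
    obtain ⟨ψ, u⟩ := i
    obtain ⟨v, rfl⟩ := exists_eq_mk_comp u
    rw [hsmul, hc, hc, hc, ← AddChar.map_add_eq_mul, ← affineTop_mul (hG g.2) (hG h.2)]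
    rfl
  refine mFaithful_le_card (monomialRep c h1 hmul) ((injective_iff_map_eq_one _).2 fun g hg => ?_)
  have key (ψ : S) (v : Fin k → R) := monomialRep_eq_one hg ⟨ψ, fun i => Ideal.Quotient.mk _ (v i)⟩
  refine Subtype.ext (eq_one_of_affine_eq (hG g.2) (fun v => ?_) fun v => ?_)
  · refine hS _ fun ψ hψ => ?_
    rw [← hc g ⟨ψ, hψ⟩ v]
    exact (key ⟨ψ, hψ⟩ v).2
  · funext i
    -- Fixing every index puts the difference in each conductor, hence in the kernel of each `ψ ∈
    -- S`.
    refine sub_eq_zero.1 (hS _ fun ψ hψ => ?_)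
    have h2 := (key ⟨ψ, hψ⟩ v).1
    rw [hsmul] at h2
    have h3 := congrFun (eq_of_heq (Sigma.mk.inj h2).2) i
    have h4 := Ideal.Quotient.eq.1 h3 1
    rwa [one_mul] at h4

end AffineAction

theorem mFaithful_le_of_injective {G H : Type*} [Group G] [Group H] (f : H →* G)
    (hf : Function.Injective f) : mFaithful H ≤ mFaithful G :=
  le_iInf₂ fun d ⟨ρ, hρ⟩ => iInf₂_le d ⟨ρ.comp f, hρ.comp hf⟩

theorem mFaithful_eq_of_heisenberg_le {R : Type*} [CommRing R] [Finite R] {k : ℕ}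
    {G : Subgroup (GL (Fin (k + 2)) R)} (hHG : heisenberg k R ≤ G)
    (hGU : G ≤ unitriangular (k + 2) R) : mFaithful G = mFaithful (heisenberg k R) := by
  refine le_antisymm (le_iInf₂ fun d ⟨ρ, hρ⟩ => ?_)
    (mFaithful_le_of_injective (Subgroup.inclusion hHG) (Subgroup.inclusion_injective hHG))
  let τ : heisenberg k R →* Module.End ℂ (Fin d → ℂ) :=
    (Matrix.toLinAlgEquiv' (R := ℂ) (n := Fin d)).toMulEquiv.toMonoidHom.comp
      ((Units.coeHom _).comp ρ)
  have hτ : Function.Injective τ :=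
    (Matrix.toLinAlgEquiv' (R := ℂ) (n := Fin d)).injective.comp (Units.val_injective.comp hρ)
  obtain ⟨S, hS, hcard⟩ := exists_separating_characters τ hτ
  rw [Module.finrank_fin_fun] at hcard
  exact (mFaithful_le_of_separating hGU hS).trans (Nat.cast_le.2 hcard)

theorem finite_quotient_maximalIdeal_pow (F : Type*) [Field F] [ValuativeRel F]
    [TopologicalSpace F] [IsNonarchimedeanLocalField F] (n : ℕ) : Finite (𝒪[F] ⧸ 𝓂[F] ^ n) := by
  have : Finite (𝒪[F] ⧸ 𝓂[F]) := inferInstanceAs (Finite 𝓀[F])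
  exact Ideal.finite_quotient_pow (IsNoetherian.noetherian _) n

theorem theorem2 (F : Type*) [Field F] [ValuativeRel F] [TopologicalSpace F]
    [IsNonarchimedeanLocalField F] (hchar : ringChar 𝓀[F] ≠ 2) (k n : ℕ)
    (G : Subgroup (GL (Fin (k + 2)) (𝒪[F] ⧸ 𝓂[F] ^ n)))
    (hHG : heisenberg k (𝒪[F] ⧸ 𝓂[F] ^ n) ≤ G)
    (hGU : G ≤ unitriangular (k + 2) (𝒪[F] ⧸ 𝓂[F] ^ n)) :
    mFaithful G = mFaithful (heisenberg k (𝒪[F] ⧸ 𝓂[F] ^ n)) := by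
  have := finite_quotient_maximalIdeal_pow F n
  exact mFaithful_eq_of_heisenberg_le hHG hGU
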